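/- All graphs are finite and simple. For a graph $G$ and a vertex $u$, let $N[u]$ denote the closed neighbourhood of $u$; a set $D\subseteq V(G)$ is dominating if $\bigcup_{u\in D}N[u]=V(G)$. In the Maker–Breaker domination game on $G$, Dominator and Staller alternately choose a vertex of $G$ that has not been chosen before. Dominator wins as soon as the vertices he has chosen form a dominating set; Staller wins if this never happens. If Dominator has a winning strategy when he moves first, let $\gamma_{\rm MB}(G)$ be the least $k$ such that, moving first, he has a strategy that makes him win after at most $k$ moves of his own, however Staller plays; otherwise let $\gamma_{\rm MB}(G)=\infty$. Let $\gamma'_{\rm MB}(G)$ be defined in the same way for the game in which Staller moves first. Let $G\cup H$ denote the disjoint union of $G$ and $H$. For $k\ge 1$ let $Y_k$ be the graph consisting of $k$ triangles that share exactly one common vertex, the centre. For $1\le m\le n$ let $X_{n,m}$ be the graph obtained from disjoint copies of $Y_n$ and $Y_m$ by adding an edge between their centres. **Theorem.** For all graphs $G$ and $H$: (i) $\gamma_{\rm MB}(G)+\gamma_{\rm MB}(H)\le \gamma_{\rm MB}(G\cup H)\le \min\{\gamma'_{\rm MB}(G)+\gamma_{\rm MB}(H),\ \gamma_{\rm MB}(G)+\gamma'_{\rm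 MB}(H)\}$; (ii) $\max\{\gamma'_{\rm MB}(G)+\gamma_{\rm MB}(H),\ \gamma_{\rm MB}(G)+\gamma'_{\rm MB}(H)\}\le \gamma'_{\rm MB}(G\cup H)\le \gamma'_{\rm MB}(G)+\gamma'_{\rm MB}(H)$. Moreover, all four bounds are sharp, as the following families show. One has $\gamma_{\rm MB}(X_{n,m})=m+1$ and $\gamma'_{\rm MB}(X_{n,m})=n+1$ for $1\le m\le n$, and $\gamma_{\rm MB}(Y_k)=1$ and $\gamma'_{\rm MB}(Y_k)=k$ for $k\ge 1$. For $1\le k\le m\le n$, $$\gamma_{\rm MB}(X_{n,m}\cup Y_k)=m+2=\gamma_{\rm MB}(X_{n,m})+\gamma_{\rm MB}(Y_k),\qquad \gamma'_{\rm MB}(X_{n,m}\cup Y_k)=n+1+k=\gamma'_{\rm MB}(X_{n,m})+\gamma'_{\rm MB}(Y_k),$$ so the lower bound of (i) and the upper bound of (ii) are attained. For $1\le k_1\le k_2$, $$\gamma_{\rm MB}(Y_{k_1}\cup Y_{k_2})=k_1+1=\min\{\gamma'_{\rm MB}(Y_{k_1})+\gamma_{\rm MB}(Y_{k_2}),\ \gamma_{\rm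 MB}(Y_{k_1})+\gamma'_{\rm MB}(Y_{k_2})\},$$ $$\gamma'_{\rm MB}(Y_{k_1}\cup Y_{k_2})=1+k_2=\max\{\gamma'_{\rm MB}(Y_{k_1})+\gamma_{\rm MB}(Y_{k_2}),\ \gamma_{\rm MB}(Y_{k_1})+\gamma'_{\rm MB}(Y_{k_2})\},$$ so the upper bound of (i) and the lower bound of (ii) are attained. -/

import Mathlib

namespace MBDomination

/-- The closed neighbourhood `N[u]`. -/
def closedNeighborSet {V : Type*} (G : SimpleGraph V) (u : V) : Set V :=
  insert u (G.neighborSet u)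

/-- `D` is a dominating set of `G`: the closed neighbourhoods of its vertices cover `V(G)`. -/
def IsDominatingSet {V : Type*} (G : SimpleGraph V) (D : Set V) : Prop :=
  (⋃ u ∈ D, closedNeighborSet G u) = Set.univ

/-- The two players of the Maker-Breaker domination game. -/
inductive Player where
  | dominator
  | staller

/-- `CanWin G p k D S`: in the Maker-Breaker domination game on `G`, from the position in which
Dominator has already chosen the vertices in `D`, Staller those in `S`, and `p` is to move,
Dominator has a strategy by which, however Staller plays, his vertices form a dominating set
after at most `k` further moves of his own.

If `D` is not dominating, the player to move must choose a vertex outside `D ∪ S`; if there is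
none, Dominator has lost. -/
inductive CanWin {V : Type*} (G : SimpleGraph V) : Player → ℕ → Set V → Set V → Prop
  | dominated {p : Player} {k : ℕ} {D S : Set V} (hD : IsDominatingSet G D) :
      CanWin G p k D S
  | dominatorMove {k : ℕ} {D S : Set V} (v : V) (hv : v ∉ D ∪ S)
      (h : CanWin G Player.staller k (insert v D) S) :
      CanWin G Player.dominator (k + 1) D S
  | stallerMove {k : ℕ} {D S : Set V} (hlegal : ∃ w, w ∉ D ∪ S)
      (h : ∀ w, w ∉ D ∪ S → CanWin G Player.dominator k D (insert w S)) :
      CanWin G Player.staller k D S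

/-- The least number of moves within which Dominator can win on `G` when `p` moves first from the
empty position; it is `⊤` if Dominator has no winning strategy. -/
noncomputable def minMoves {V : Type*} (G : SimpleGraph V) (p : Player) : ℕ∞ :=
  ⨅ (k : ℕ) (_ : CanWin G p k ∅ ∅), (k : ℕ∞)

/-- The Maker-Breaker domination number `γ_MB(G)` (Dominator moves first). -/
noncomputable def gammaMB {V : Type*} (G : SimpleGraph V) : ℕ∞ :=
  minMoves G Player.dominator

/-- The Maker-Breaker domination number `γ'_MB(G)` (Staller moves first). -/
noncomputable def gammaMB' {V : Type*} (G : SimpleGraph V) : ℕ∞ :=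
  minMoves G Player.staller

/-- The vertices of `graphY k`: the centre `none`, and the two outer vertices `some (i, false)`,
`some (i, true)` of the `i`-th triangle, for `i < k`. -/
abbrev VertY (k : ℕ) : Type := Option (Fin k × Bool)

/-- The graph `Y_k`: `k` triangles sharing one common vertex, the centre. -/
def graphY (k : ℕ) : SimpleGraph (VertY k) :=
  SimpleGraph.fromRel fun a b =>
    match a, b with
    | none, some _ => True
    | some p, some q => p.1 = q.1
    | _, _ => False

/-- The graph `X_{n,m}`: disjoint copies of `Y_n` and `Y_m` together with an edge that joins their
centres. -/
def graphX (n m : ℕ) : SimpleGraph (VertY n ⊕ VertY m) :=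
  (graphY n ⊕g graphY m) ⊔ SimpleGraph.edge (Sum.inl none) (Sum.inr none)

end MBDomination

/-! The upper bounds hold because Dominator can always reply in the part where Staller has just
moved, so winning strategies on the two parts run side by side and their budgets add
(`CanWin.sum_staller`, `CanWin.sum_dominator`). The lower bounds hold because Staller can likewise
answer in the part where Dominator has just moved. `CanWin.split` extracts separate budgets by
induction on a win in the union: with Dominator to move, both parts are won with Dominator to move;
with Staller to move, either part may be taken as the one where Staller moves. Monotonicity
(`CanWin.mono`) makes forced extra moves harmless.

For the families, a set dominates `Y_k` exactly when it contains the centre or meets every outer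
pair. Taking the centre costs one move, pairing costs `k`, and a dominating set without the centre
has at least `k` vertices. The edge between the centres of `X_{n,m}` does not affect domination, so
every value comes from disjoint unions of graphs `Y_k`. -/

namespace MBDomination

universe u v

/-! ### The game on one graph: monotonicity, invariance, pairing -/

section Game

variable {V : Type u} {W : Type v} {G : SimpleGraph V} {H : SimpleGraph W}

theorem isDominatingSet_iff {D : Set V} :
    IsDominatingSet G D ↔ ∀ v, v ∈ D ∨ ∃ u ∈ D, G.Adj u v := by
  simp only [IsDominatingSet, Set.eq_univ_iff_forall, Set.mem_iUnion, closedNeighborSet,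
    Set.mem_insert_iff, SimpleGraph.mem_neighborSet, exists_prop]
  refine forall_congr' fun v => ⟨?_, ?_⟩
  · rintro ⟨u, hu, rfl | h⟩
    · exact Or.inl hu
    · exact Or.inr ⟨u, hu, h⟩
  · rintro (h | ⟨u, hu, h⟩)
    · exact ⟨v, h, Or.inl rfl⟩
    · exact ⟨u, hu, Or.inr h⟩

theorem IsDominatingSet.mono {D D' : Set V} (h : IsDominatingSet G D) (hD : D ⊆ D') :
    IsDominatingSet G D' := by
  rw [isDominatingSet_iff] at h ⊢
  exact fun v => (h v).imp (@hD v) fun ⟨u, hu, ha⟩ => ⟨u, hD hu, ha⟩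

theorem isDominatingSet_sum_iff {D : Set (V ⊕ W)} :
    IsDominatingSet (G ⊕g H) D ↔
      IsDominatingSet G (Sum.inl ⁻¹' D) ∧ IsDominatingSet H (Sum.inr ⁻¹' D) := by
  simp [isDominatingSet_iff]

/-- If Dominator can win, he wins in particular by some set of at most `k` vertices that Staller
has not chosen. -/
theorem CanWin.exists_finset [DecidableEq V] {p : Player} {k : ℕ} {D S : Set V}
    (h : CanWin G p k D S) :
    ∃ F : Finset V, F.card ≤ k ∧ Disjoint (F : Set V) S ∧ IsDominatingSet G (D ∪ F) := by
  induction h with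
  | dominated hD => exact ⟨∅, by simp, by simp, by simpa using hD⟩
  | @dominatorMove k D S v hv _ ih =>
    obtain ⟨F, hF, hS, hd⟩ := ih
    refine ⟨insert v F, (Finset.card_insert_le _ _).trans (by omega), ?_, ?_⟩
    · rw [Finset.coe_insert, Set.disjoint_insert_left]
      exact ⟨fun h => hv (Or.inr h), hS⟩
    · rw [Finset.coe_insert, Set.union_insert, ← Set.insert_union]
      exact hd
  | @stallerMove k D S hlegal _ ih =>
    obtain ⟨w, hw⟩ := hlegal
    obtain ⟨F, hF, hS, hd⟩ := ih w hw
    exact ⟨F, hF, hS.mono_right (Set.subset_insert _ _), hd⟩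

/-- The vertices with which Dominator eventually wins avoid `S`. This settles full boards, where no
move is legal. -/
theorem CanWin.isDominatingSet_union_compl {p : Player} {k : ℕ} {D S : Set V}
    (h : CanWin G p k D S) : IsDominatingSet G (D ∪ Sᶜ) := by
  classical
  obtain ⟨F, -, hS, hd⟩ := h.exists_finset
  exact hd.mono (Set.union_subset_union_right _ hS.subset_compl_right)

/-- A position stays won if Dominator gets more vertices, Staller fewer, and the number of moves
allowed grows. -/
theorem CanWin.mono {p : Player} {k k' : ℕ} {D D' S S' : Set V} (h : CanWin G p k D S)
    (hk : k ≤ k') (hD : D ⊆ D') (hS : S' ⊆ S ∪ D') : CanWin G p k' D' S' := by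
  -- On a full board `D'` contains `D ∪ Sᶜ`, so it is already dominating.
  by_cases hlegal : ∃ w, w ∉ D' ∪ S'
  swap
  · push Not at hlegal
    refine .dominated (h.isDominatingSet_union_compl.mono (Set.union_subset hD fun v hv => ?_))
    rcases hlegal v with h1 | h1
    · exact h1
    · exact (hS h1).resolve_left hv
  induction h generalizing k' D' S' with
  | dominated hdom => exact .dominated (hdom.mono hD)
  | @dominatorMove k D S v hv h ih =>
    obtain ⟨k', rfl⟩ : ∃ j, k' = j + 1 := ⟨k' - 1, by omega⟩
    -- If Dominator already owns the prescribed vertex, any free vertex serves as his move.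
    obtain ⟨w, hw, hDw⟩ : ∃ w, w ∉ D' ∪ S' ∧ insert v D ⊆ insert w D' := by
      by_cases hv' : v ∈ D'
      · obtain ⟨w, hw⟩ := hlegal
        exact ⟨w, hw, Set.insert_subset (Or.inr hv') (hD.trans (Set.subset_insert _ _))⟩
      · refine ⟨v, ?_, Set.insert_subset_insert hD⟩
        rintro (h1 | h1)
        · exact hv' h1
        · exact (hS h1).elim (fun h2 => hv (Or.inr h2)) hv'
    have hSw : S' ⊆ S ∪ insert w D' :=
      hS.trans (Set.union_subset_union_right _ (Set.subset_insert _ _))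
    refine .dominatorMove w hw ?_
    by_cases hl : ∃ x, x ∉ insert w D' ∪ S'
    · exact ih (by omega) hDw hSw hl
    · push Not at hl
      refine .dominated (h.isDominatingSet_union_compl.mono
        (Set.union_subset hDw fun x hx => ?_))
      rcases hl x with h1 | h1
      · exact h1
      · exact (hSw h1).resolve_left hx
  | @stallerMove k D S hlegal' h ih =>
    refine .stallerMove hlegal fun w hw => ?_
    -- If `w` was already Staller's in the original position, an arbitrary legal move `x` is
    -- imagined there instead.
    obtain ⟨x, hx, hSx⟩ : ∃ x, x ∉ D ∪ S ∧ insert w S' ⊆ insert x S ∪ D' := by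
      by_cases hwS : w ∈ S
      · obtain ⟨x, hx⟩ := hlegal'
        exact ⟨x, hx, Set.insert_subset (Or.inl (Or.inr hwS))
          (hS.trans (Set.union_subset_union_left _ (Set.subset_insert _ _)))⟩
      · refine ⟨w, ?_, ?_⟩
        · rintro (h1 | h1)
          · exact hw (Or.inl (hD h1))
          · exact hwS h1
        · rw [Set.insert_union]
          exact Set.insert_subset_insert hS
    by_cases hl : ∃ y, y ∉ D' ∪ insert w S'
    · exact ih x hx hk hD hSx hl
    · push Not at hl
      refine .dominated ((h x hx).isDominatingSet_union_compl.mono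
        (Set.union_subset hD fun y hy => ?_))
      rcases hl y with h1 | h1
      · exact h1
      · exact (hSx h1).resolve_left hy

theorem CanWin.mono_nat {p : Player} {k k' : ℕ} {D S : Set V} (h : CanWin G p k D S)
    (hk : k ≤ k') : CanWin G p k' D S :=
  h.mono hk subset_rfl Set.subset_union_left

theorem CanWin.anti_staller {p : Player} {k : ℕ} {D S S' : Set V} (h : CanWin G p k D S)
    (hS : S' ⊆ S) : CanWin G p k D S' :=
  h.mono le_rfl subset_rfl (hS.trans Set.subset_union_left)

/-- It does not hurt Dominator to be the one to move. -/
theorem CanWin.dominator {k : ℕ} {D S : Set V} (h : CanWin G .staller k D S) :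
    CanWin G .dominator k D S := by
  cases h with
  | dominated hD => exact .dominated hD
  | stallerMove hl h =>
    obtain ⟨w, hw⟩ := hl
    exact (h w hw).anti_staller (Set.subset_insert _ _)

theorem CanWin.congr {G' : SimpleGraph V}
    (hGG' : ∀ D, IsDominatingSet G D ↔ IsDominatingSet G' D) {p : Player} {k : ℕ} {D S : Set V}
    (h : CanWin G p k D S) : CanWin G' p k D S := by
  induction h with
  | dominated hD => exact .dominated ((hGG' _).1 hD)
  | dominatorMove v hv _ ih => exact .dominatorMove v hv ih
  | stallerMove hl _ ih => exact .stallerMove hl ih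

theorem IsDominatingSet.preimage_iso (e : H ≃g G) {D : Set V} (h : IsDominatingSet G D) :
    IsDominatingSet H (e ⁻¹' D) := by
  rw [isDominatingSet_iff] at h ⊢
  intro w
  refine (h (e w)).imp id fun ⟨u, hu, ha⟩ => ⟨e.symm u, by simpa using hu, ?_⟩
  rw [← e.map_adj_iff]
  simpa using ha

theorem CanWin.preimage_iso (e : H ≃g G) {p : Player} {k : ℕ} {D S : Set V}
    (h : CanWin G p k D S) : CanWin H p k (e ⁻¹' D) (e ⁻¹' S) := by
  have key : ∀ (v : V) (A : Set V), e ⁻¹' insert v A = insert (e.symm v) (e ⁻¹' A) := by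
    intro v A
    ext w
    simp only [Set.mem_preimage, Set.mem_insert_iff]
    exact or_congr_left ⟨fun h => by simp [← h], fun h => by simp [h]⟩
  induction h with
  | dominated hD => exact .dominated (hD.preimage_iso e)
  | dominatorMove v hv _ ih =>
    refine .dominatorMove (e.symm v) (by simpa using hv) ?_
    rwa [← key]
  | stallerMove hl _ ih =>
    obtain ⟨w, hw⟩ := hl
    refine .stallerMove ⟨e.symm w, by simpa using hw⟩ fun x hx => ?_
    have := ih (e x) hx
    rwa [key, e.symm_apply_apply] at this

/-- Winning is monotone in the budget, so failure at `k` forces every winning budget to be at least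
`k + 1`. -/
theorem minMoves_le_iff {p : Player} {k : ℕ} : minMoves G p ≤ k ↔ CanWin G p k ∅ ∅ := by
  refine ⟨fun h => ?_, fun h => iInf₂_le k h⟩
  by_contra hc
  have : ((k + 1 : ℕ) : ℕ∞) ≤ minMoves G p := by
    refine le_iInf₂ fun j hj => ?_
    have : k < j := by
      by_contra hjk
      exact hc (hj.mono_nat (by omega))
    exact_mod_cast this
  have := this.trans h
  norm_cast at this
  omega

theorem exists_of_minMoves_ne_top {p : Player} (h : minMoves G p ≠ ⊤) :
    ∃ k : ℕ, minMoves G p = k ∧ CanWin G p k ∅ ∅ := by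
  obtain ⟨k, hk⟩ := ENat.ne_top_iff_exists.1 h
  exact ⟨k, hk.symm, minMoves_le_iff.1 hk.symm.le⟩

theorem le_minMoves {p : Player} {a : ℕ∞} (h : ∀ k : ℕ, CanWin G p k ∅ ∅ → a ≤ k) :
    a ≤ minMoves G p :=
  le_iInf₂ h

theorem minMoves_congr {G' : SimpleGraph V}
    (hGG' : ∀ D, IsDominatingSet G D ↔ IsDominatingSet G' D) (p : Player) :
    minMoves G p = minMoves G' p :=
  le_antisymm (le_minMoves fun _ h => minMoves_le_iff.2 (h.congr fun D => (hGG' D).symm))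
    (le_minMoves fun _ h => minMoves_le_iff.2 (h.congr hGG'))

theorem minMoves_iso (e : G ≃g H) (p : Player) : minMoves G p = minMoves H p :=
  le_antisymm (le_minMoves fun _ h => minMoves_le_iff.2 (by simpa using h.preimage_iso e))
    (le_minMoves fun _ h => minMoves_le_iff.2 (by simpa using h.preimage_iso e.symm))

/-- Pairing strategy: if every completion of `D` that meets each of the free pairs
`{f i false, f i true}`, `i ∈ T`, is dominating, then Dominator, moving second, needs at most one
move per pair. -/
theorem CanWin.of_pairing {ι : Type*} [DecidableEq ι] (f : ι × Bool → V)
    (hf : Function.Injective f) (T : Finset ι) {D S : Set V}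
    (hfree : ∀ i ∈ T, ∀ b, f (i, b) ∉ D ∪ S)
    (hdom : ∀ D', D ⊆ D' → (∀ i ∈ T, ∃ b, f (i, b) ∈ D') → IsDominatingSet G D') :
    CanWin G .staller T.card D S := by
  induction hT : T.card generalizing T D S with
  | zero =>
    rw [Finset.card_eq_zero] at hT
    subst hT
    exact .dominated (hdom D subset_rfl (by simp))
  | succ n ih =>
    obtain ⟨i₀, hi₀⟩ : T.Nonempty := Finset.card_pos.1 (by omega)
    refine .stallerMove ⟨f (i₀, true), hfree i₀ hi₀ true⟩ fun w hw => ?_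
    -- The reply is the partner of `w` if `w` lies in a pair of `T`, and otherwise a vertex of any
    -- pair; all other pairs stay free.
    obtain ⟨i, hi, b, hb, hother⟩ : ∃ i ∈ T, ∃ b, f (i, b) ≠ w ∧
        ∀ j ∈ T, j ≠ i → ∀ c, f (j, c) ≠ w := by
      by_cases h : ∃ i ∈ T, ∃ b, f (i, b) = w
      · obtain ⟨i, hi, b, rfl⟩ := h
        refine ⟨i, hi, !b, fun h => ?_, fun j _ hj c h => hj (congrArg Prod.fst (hf h))⟩
        simpa using congrArg Prod.snd (hf h)
      · push Not at h
        exact ⟨i₀, hi₀, true, h i₀ hi₀ true, fun j hj _ c => h j hj c⟩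
    refine .dominatorMove (f (i, b)) ?_ (ih (T.erase i) ?_ ?_ ?_)
    · rintro (h | rfl | h)
      · exact hfree i hi b (Or.inl h)
      · exact hb rfl
      · exact hfree i hi b (Or.inr h)
    · rintro j hj c ((h | h) | h | h)
      · exact (Finset.ne_of_mem_erase hj) (congrArg Prod.fst (hf h))
      · exact hfree j (Finset.mem_of_mem_erase hj) c (Or.inl h)
      · exact hother j (Finset.mem_of_mem_erase hj) (Finset.ne_of_mem_erase hj) c h
      · exact hfree j (Finset.mem_of_mem_erase hj) c (Or.inr h)
    · intro D' hD' hmeet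
      refine hdom D' ((Set.subset_insert _ _).trans hD') fun j hj => ?_
      by_cases hji : j = i
      · subst hji
        exact ⟨b, hD' (Set.mem_insert _ _)⟩
      · exact hmeet j (Finset.mem_erase.2 ⟨hji, hj⟩)
    · rw [Finset.card_erase_of_mem hi]
      omega

end Game

/-! ### The game on a disjoint union and the four bounds -/

section DisjointUnion

variable {V : Type u} {W : Type v} {G : SimpleGraph V} {H : SimpleGraph W}

theorem preimage_inl_insert_inl (v : V) (A : Set (V ⊕ W)) :
    (Sum.inl ⁻¹' insert (Sum.inl v) A : Set V) = insert v (Sum.inl ⁻¹' A) := by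
  ext; simp

theorem preimage_inr_insert_inl (v : V) (A : Set (V ⊕ W)) :
    (Sum.inr ⁻¹' insert (Sum.inl v) A : Set W) = Sum.inr ⁻¹' A := by
  ext; simp

theorem preimage_inl_insert_inr (w : W) (A : Set (V ⊕ W)) :
    (Sum.inl ⁻¹' insert (Sum.inr w) A : Set V) = Sum.inl ⁻¹' A := by
  ext; simp

theorem preimage_inr_insert_inr (w : W) (A : Set (V ⊕ W)) :
    (Sum.inr ⁻¹' insert (Sum.inr w) A : Set W) = insert w (Sum.inr ⁻¹' A) := by
  ext; simp

/-- The position on `G ⊕g H` assembled from a position on each part. -/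
abbrev sumSet (A : Set V) (B : Set W) : Set (V ⊕ W) := Sum.elim A B

theorem insert_inl_sumSet (v : V) (A : Set V) (B : Set W) :
    insert (Sum.inl v) (sumSet A B) = sumSet (insert v A) B := by
  ext (x | x)
  · change (_ ∨ x ∈ A) ↔ (_ ∨ x ∈ A)
    simp
  · change (_ ∨ x ∈ B) ↔ x ∈ B
    simp

theorem insert_inr_sumSet (w : W) (A : Set V) (B : Set W) :
    insert (Sum.inr w) (sumSet A B) = sumSet A (insert w B) := by
  ext (x | x)
  · change (_ ∨ x ∈ A) ↔ x ∈ A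
    simp
  · change (_ ∨ x ∈ B) ↔ (_ ∨ x ∈ B)
    simp

theorem sumSet_empty : sumSet (∅ : Set V) (∅ : Set W) = ∅ := by
  ext (x | x) <;> exact Iff.rfl

theorem isDominatingSet_sumSet {A : Set V} {B : Set W} (hA : IsDominatingSet G A)
    (hB : IsDominatingSet H B) : IsDominatingSet (G ⊕g H) (sumSet A B) :=
  isDominatingSet_sum_iff.2 ⟨hA, hB⟩

theorem CanWin.swap {p : Player} {k : ℕ} {D S : Set V} {D' S' : Set W}
    (h : CanWin (G ⊕g H) p k (sumSet D D') (sumSet S S')) :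
    CanWin (H ⊕g G) p k (sumSet D' D) (sumSet S' S) := by
  have key : ∀ (A : Set V) (B : Set W),
      (SimpleGraph.Iso.sumComm : H ⊕g G ≃g G ⊕g H) ⁻¹' sumSet A B = sumSet B A := by
    intro A B
    ext (x | x) <;> exact Iff.rfl
  simpa only [key] using h.preimage_iso (SimpleGraph.Iso.sumComm : H ⊕g G ≃g G ⊕g H)

/-- Once `G` is dominated, a Staller move there amounts to a pass in `H`. It is treated as an
arbitrary legal move in `H`, which is then erased from Staller's set. -/
theorem CanWin.sum_of_isDominatingSet_left {p : Player} {k : ℕ} {D S : Set V} {D' S' : Set W}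
    (hD : IsDominatingSet G D) (h : CanWin H p k D' S') :
    CanWin (G ⊕g H) p k (sumSet D D') (sumSet S S') := by
  induction h generalizing S with
  | dominated hD' => exact .dominated (isDominatingSet_sumSet hD hD')
  | dominatorMove v hv _ ih =>
    refine .dominatorMove (Sum.inr v) hv ?_
    rw [insert_inr_sumSet]
    exact ih
  | stallerMove hl _ ih =>
    obtain ⟨x, hx⟩ := hl
    refine .stallerMove ⟨Sum.inr x, hx⟩ ?_
    rintro (w | w) hw
    · have := ih x hx (S := insert w S)
      rw [← insert_inr_sumSet] at this
      rw [insert_inl_sumSet]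
      exact this.anti_staller (Set.subset_insert _ _)
    · rw [insert_inr_sumSet]
      exact ih w hw

theorem CanWin.sum_staller {a b : ℕ} {D S : Set V} {D' S' : Set W}
    (hG : CanWin G .staller a D S) (hH : CanWin H .staller b D' S') :
    CanWin (G ⊕g H) .staller (a + b) (sumSet D D') (sumSet S S') := by
  -- Each reply of Dominator uses up one move of the budget of the part just played in.
  induction hn : a + b using Nat.strong_induction_on generalizing a b D S D' S' with
  | _ n ih =>
  subst hn
  cases hG with
  | dominated hD => exact (hH.sum_of_isDominatingSet_left hD).mono_nat (Nat.le_add_left _ _)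
  | stallerMove hl h =>
  have hG : CanWin G .staller a D S := .stallerMove hl h
  cases hH with
  | dominated hD =>
    exact (hG.sum_of_isDominatingSet_left hD).swap.mono_nat (Nat.le_add_right _ _)
  | stallerMove hl' h' =>
  have hH : CanWin H .staller b D' S' := .stallerMove hl' h'
  obtain ⟨x, hx⟩ := hl
  refine .stallerMove ⟨Sum.inl x, hx⟩ ?_
  rintro (w | w) hw
  · rw [insert_inl_sumSet]
    cases h w hw with
    | dominated hD =>
      exact (hH.sum_of_isDominatingSet_left hD).dominator.mono_nat (Nat.le_add_left _ _)
    | @dominatorMove a _ _ v hv h =>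
      rw [Nat.add_right_comm]
      refine .dominatorMove (Sum.inl v) hv ?_
      rw [insert_inl_sumSet]
      exact ih (a + b) (by omega) h hH rfl
  · rw [insert_inr_sumSet]
    cases h' w hw with
    | dominated hD =>
      exact (hG.sum_of_isDominatingSet_left hD).swap.dominator.mono_nat (Nat.le_add_right _ _)
    | @dominatorMove b _ _ v hv h =>
      refine .dominatorMove (Sum.inr v) hv ?_
      rw [insert_inr_sumSet]
      exact ih (a + b) (by omega) hG h rfl

theorem CanWin.sum_dominator {a b : ℕ} {D S : Set V} {D' S' : Set W}
    (hG : CanWin G .dominator a D S) (hH : CanWin H .staller b D' S') :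
    CanWin (G ⊕g H) .dominator (a + b) (sumSet D D') (sumSet S S') := by
  cases hG with
  | dominated hD =>
    exact (hH.sum_of_isDominatingSet_left hD).dominator.mono_nat (Nat.le_add_left _ _)
  | @dominatorMove a _ _ v hv h =>
    rw [Nat.add_right_comm]
    refine .dominatorMove (Sum.inl v) hv ?_
    rw [insert_inl_sumSet]
    exact h.sum_staller hH

/-- If Dominator wins with Staller having any first move in `G`, with bounds that may depend on
this move but whose sum with a sufficient bound for `H` is at most `n`, the bounds can be chosen
uniformly. -/
theorem exists_uniform_of_forall_staller {n : ℕ} {D S : Set V} {D' S' : Set W}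
    (hl : ∃ w, w ∉ D ∪ S)
    (h : ∀ w, w ∉ D ∪ S → ∃ a b, a + b ≤ n ∧ CanWin G .dominator a D (insert w S) ∧
      CanWin H .dominator b D' S') :
    ∃ a b, a + b ≤ n ∧ CanWin G .staller a D S ∧ CanWin H .dominator b D' S' := by
  classical
  have hex : ∃ b, CanWin H .dominator b D' S' := by
    obtain ⟨w, hw⟩ := hl
    obtain ⟨_, b, _, _, hb⟩ := h w hw
    exact ⟨b, hb⟩
  have hle : Nat.find hex ≤ n := by
    obtain ⟨w, hw⟩ := hl
    obtain ⟨a, b, hab, _, hb⟩ := h w hw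
    have := Nat.find_min' hex hb
    omega
  -- The position on `H` does not depend on `w`, so its least budget serves every `w` and leaves `G`
  -- at least as much as each given `a`.
  refine ⟨n - Nat.find hex, Nat.find hex, by omega, .stallerMove hl fun w hw => ?_,
    Nat.find_spec hex⟩
  obtain ⟨a, b, hab, ha, hb⟩ := h w hw
  have := Nat.find_min' hex hb
  exact ha.mono_nat (by omega)

/-- On a full board the only way to have won is to dominate already, so the turn is irrelevant. In a
union, one part can be full while the other is not. -/
theorem CanWin.staller_of_forall_mem {k : ℕ} {D S : Set V} (h : CanWin G .dominator k D S)
    (hl : ¬∃ w, w ∉ D ∪ S) : CanWin G .staller k D S := by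
  cases h with
  | dominated hD => exact .dominated hD
  | dominatorMove v hv _ => exact absurd ⟨v, hv⟩ hl

/-- Staller, answering in the part where Dominator moves, forces Dominator to play both games to
the end. -/
theorem CanWin.split {p : Player} {n : ℕ} {D S : Set (V ⊕ W)} (h : CanWin (G ⊕g H) p n D S) :
    (p = .dominator → ∃ a b, a + b ≤ n ∧
      CanWin G .dominator a (Sum.inl ⁻¹' D) (Sum.inl ⁻¹' S) ∧
      CanWin H .dominator b (Sum.inr ⁻¹' D) (Sum.inr ⁻¹' S)) ∧
    (p = .staller →
      (∃ a b, a + b ≤ n ∧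
        CanWin G .staller a (Sum.inl ⁻¹' D) (Sum.inl ⁻¹' S) ∧
        CanWin H .dominator b (Sum.inr ⁻¹' D) (Sum.inr ⁻¹' S)) ∧
      ∃ a b, a + b ≤ n ∧
        CanWin G .dominator a (Sum.inl ⁻¹' D) (Sum.inl ⁻¹' S) ∧
        CanWin H .staller b (Sum.inr ⁻¹' D) (Sum.inr ⁻¹' S)) := by
  induction h with
  | dominated hD =>
    obtain ⟨h1, h2⟩ := isDominatingSet_sum_iff.1 hD
    have hn := Nat.zero_le
    exact ⟨fun _ => ⟨0, 0, hn _, .dominated h1, .dominated h2⟩,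
      fun _ => ⟨⟨0, 0, hn _, .dominated h1, .dominated h2⟩,
        ⟨0, 0, hn _, .dominated h1, .dominated h2⟩⟩⟩
  | dominatorMove v hv _ ih =>
    refine ⟨fun _ => ?_, nofun⟩
    -- The half used is the one with Staller to move in the part of `v`; prepending `v` gives the
    -- move back to Dominator there.
    obtain ⟨ih1, ih2⟩ := ih.2 rfl
    rcases v with v | v
    · obtain ⟨a, b, hab, ha, hb⟩ := ih1
      rw [preimage_inl_insert_inl] at ha
      rw [preimage_inr_insert_inl] at hb
      exact ⟨a + 1, b, by omega, .dominatorMove v hv ha, hb⟩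
    · obtain ⟨a, b, hab, ha, hb⟩ := ih2
      rw [preimage_inl_insert_inr] at ha
      rw [preimage_inr_insert_inr] at hb
      exact ⟨a, b + 1, by omega, ha, .dominatorMove v hv hb⟩
  | @stallerMove k D S hl _ ih =>
    refine ⟨nofun, fun _ => ?_⟩
    have ihG : ∀ w : V, w ∉ (Sum.inl ⁻¹' D : Set V) ∪ Sum.inl ⁻¹' S → ∃ a b, a + b ≤ k ∧
        CanWin G .dominator a (Sum.inl ⁻¹' D) (insert w (Sum.inl ⁻¹' S)) ∧
        CanWin H .dominator b (Sum.inr ⁻¹' D) (Sum.inr ⁻¹' S) := by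
      intro w hw
      have := (ih (Sum.inl w) hw).1 rfl
      rwa [preimage_inl_insert_inl, preimage_inr_insert_inl] at this
    have ihH : ∀ w : W, w ∉ (Sum.inr ⁻¹' D : Set W) ∪ Sum.inr ⁻¹' S → ∃ a b, a + b ≤ k ∧
        CanWin G .dominator a (Sum.inl ⁻¹' D) (Sum.inl ⁻¹' S) ∧
        CanWin H .dominator b (Sum.inr ⁻¹' D) (insert w (Sum.inr ⁻¹' S)) := by
      intro w hw
      have := (ih (Sum.inr w) hw).1 rfl
      rwa [preimage_inl_insert_inr, preimage_inr_insert_inr] at this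
    have hboth : ∃ a b, a + b ≤ k ∧
        CanWin G .dominator a (Sum.inl ⁻¹' D) (Sum.inl ⁻¹' S) ∧
        CanWin H .dominator b (Sum.inr ⁻¹' D) (Sum.inr ⁻¹' S) := by
      obtain ⟨w | w, hw⟩ := hl
      · obtain ⟨a, b, hab, ha, hb⟩ := ihG w hw
        exact ⟨a, b, hab, ha.anti_staller (Set.subset_insert _ _), hb⟩
      · obtain ⟨a, b, hab, ha, hb⟩ := ihH w hw
        exact ⟨a, b, hab, ha, hb.anti_staller (Set.subset_insert _ _)⟩
    constructor
    · by_cases hlG : ∃ w : V, w ∉ (Sum.inl ⁻¹' D : Set V) ∪ Sum.inl ⁻¹' S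
      · exact exists_uniform_of_forall_staller hlG ihG
      · obtain ⟨a, b, hab, ha, hb⟩ := hboth
        exact ⟨a, b, hab, ha.staller_of_forall_mem hlG, hb⟩
    · by_cases hlH : ∃ w : W, w ∉ (Sum.inr ⁻¹' D : Set W) ∪ Sum.inr ⁻¹' S
      · obtain ⟨b, a, hab, hb, ha⟩ := exists_uniform_of_forall_staller (n := k) hlH fun w hw => by
          obtain ⟨a, b, hab, ha, hb⟩ := ihH w hw
          exact ⟨b, a, by omega, hb, ha⟩
        exact ⟨a, b, by omega, ha, hb⟩
      · obtain ⟨a, b, hab, ha, hb⟩ := hboth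
        exact ⟨a, b, hab, ha, hb.staller_of_forall_mem hlH⟩

theorem minMoves_add_le {p q : Player} {n : ℕ}
    (h : ∃ a b, a + b ≤ n ∧ CanWin G p a ∅ ∅ ∧ CanWin H q b ∅ ∅) :
    minMoves G p + minMoves H q ≤ n := by
  obtain ⟨a, b, hab, ha, hb⟩ := h
  refine (add_le_add (minMoves_le_iff.2 ha) (minMoves_le_iff.2 hb)).trans ?_
  exact_mod_cast hab

theorem minMoves_sum_le {p q r : Player}
    (h : ∀ a b, CanWin G p a ∅ ∅ → CanWin H q b ∅ ∅ →
      CanWin (G ⊕g H) r (a + b) (sumSet ∅ ∅) (sumSet ∅ ∅)) :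
    minMoves (G ⊕g H) r ≤ minMoves G p + minMoves H q := by
  by_cases hG : minMoves G p = ⊤
  · simp [hG]
  by_cases hH : minMoves H q = ⊤
  · simp [hH]
  obtain ⟨a, ha, ha'⟩ := exists_of_minMoves_ne_top hG
  obtain ⟨b, hb, hb'⟩ := exists_of_minMoves_ne_top hH
  have := h a b ha' hb'
  rw [sumSet_empty, ← minMoves_le_iff] at this
  rw [ha, hb]
  exact_mod_cast this

theorem gammaMB_sum_comm (G : SimpleGraph V) (H : SimpleGraph W) :
    gammaMB (G ⊕g H) = gammaMB (H ⊕g G) :=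
  minMoves_iso SimpleGraph.Iso.sumComm _

theorem gammaMB'_sum_comm (G : SimpleGraph V) (H : SimpleGraph W) :
    gammaMB' (G ⊕g H) = gammaMB' (H ⊕g G) :=
  minMoves_iso SimpleGraph.Iso.sumComm _

theorem gammaMB_add_le (G : SimpleGraph V) (H : SimpleGraph W) :
    gammaMB G + gammaMB H ≤ gammaMB (G ⊕g H) :=
  le_minMoves fun _ h => minMoves_add_le (h.split.1 rfl)

theorem gammaMB_sum_le (G : SimpleGraph V) (H : SimpleGraph W) :
    gammaMB (G ⊕g H) ≤ gammaMB G + gammaMB' H :=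
  minMoves_sum_le fun _ _ => CanWin.sum_dominator

theorem gammaMB_sum_le' (G : SimpleGraph V) (H : SimpleGraph W) :
    gammaMB (G ⊕g H) ≤ gammaMB' G + gammaMB H := by
  rw [gammaMB_sum_comm, add_comm]
  exact gammaMB_sum_le H G

theorem gammaMB'_add_gammaMB_le (G : SimpleGraph V) (H : SimpleGraph W) :
    gammaMB' G + gammaMB H ≤ gammaMB' (G ⊕g H) :=
  le_minMoves fun _ h => minMoves_add_le (h.split.2 rfl).1

theorem gammaMB_add_gammaMB'_le (G : SimpleGraph V) (H : SimpleGraph W) :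
    gammaMB G + gammaMB' H ≤ gammaMB' (G ⊕g H) :=
  le_minMoves fun _ h => minMoves_add_le (h.split.2 rfl).2

theorem gammaMB'_sum_le (G : SimpleGraph V) (H : SimpleGraph W) :
    gammaMB' (G ⊕g H) ≤ gammaMB' G + gammaMB' H :=
  minMoves_sum_le fun _ _ => CanWin.sum_staller

end DisjointUnion

/-! ### The graphs `Y_k` and `X_{n,m}` -/

section Families

/-- An outer vertex sees only its partner and the centre. The hypothesis `1 ≤ k` is needed for a set
of outer vertices to dominate the centre. -/
theorem isDominatingSet_graphY_iff {k : ℕ} (hk : 1 ≤ k) {D : Set (VertY k)} :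
    IsDominatingSet (graphY k) D ↔ none ∈ D ∨ ∀ i, ∃ b, some (i, b) ∈ D := by
  rw [isDominatingSet_iff]
  constructor
  · intro h
    refine or_iff_not_imp_left.2 fun hn i => ?_
    rcases h (some (i, false)) with h | ⟨_ | ⟨j, b⟩, hu, ha⟩
    · exact ⟨_, h⟩
    · exact absurd hu hn
    · have : j = i := by
        simp only [graphY, SimpleGraph.fromRel_adj] at ha
        exact ha.2.elim id Eq.symm
      subst this
      exact ⟨b, hu⟩
  · rintro (h | h)
    · rintro (_ | p)
      · exact Or.inl h
      · exact Or.inr ⟨none, h, by simp [graphY]⟩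
    · rintro (_ | ⟨i, b⟩)
      · obtain ⟨b, hb⟩ := h ⟨0, hk⟩
        exact Or.inr ⟨_, hb, by simp [graphY]⟩
      · obtain ⟨c, hc⟩ := h i
        by_cases hbc : c = b
        · subst hbc
          exact Or.inl hc
        · exact Or.inr ⟨_, hc, by simp [graphY, hbc]⟩

/-- The edge between the centres does not matter for domination. -/
theorem isDominatingSet_graphX_iff {n m : ℕ} (hn : 1 ≤ n) (hm : 1 ≤ m)
    {D : Set (VertY n ⊕ VertY m)} :
    IsDominatingSet (graphX n m) D ↔ IsDominatingSet (graphY n ⊕g graphY m) D := by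
  constructor
  · intro h
    rw [isDominatingSet_sum_iff, isDominatingSet_graphY_iff hn, isDominatingSet_graphY_iff hm]
    rw [isDominatingSet_iff] at h
    constructor
    -- It suffices to look at outer vertices, and the additional edge meets none of them.
    · refine or_iff_not_imp_left.2 fun hc i => ?_
      rcases h (Sum.inl (some (i, false))) with h | ⟨(_ | ⟨j, b⟩) | u, hu, ha⟩
      · exact ⟨_, h⟩
      · exact absurd hu hc
      · have : j = i := by
          simp [graphX, graphY, SimpleGraph.edge_adj] at ha
          exact ha.2.elim id Eq.symm
        subst this
        exact ⟨b, hu⟩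
      · simp [graphX, SimpleGraph.edge_adj] at ha
    · refine or_iff_not_imp_left.2 fun hc i => ?_
      rcases h (Sum.inr (some (i, false))) with h | ⟨u | (_ | ⟨j, b⟩), hu, ha⟩
      · exact ⟨_, h⟩
      · simp [graphX, SimpleGraph.edge_adj] at ha
      · exact absurd hu hc
      · have : j = i := by
          simp [graphX, graphY, SimpleGraph.edge_adj] at ha
          exact ha.2.elim id Eq.symm
        subst this
        exact ⟨b, hu⟩
  · intro h
    rw [isDominatingSet_iff] at h ⊢
    exact fun v => (h v).imp id fun ⟨u, hu, ha⟩ => ⟨u, hu, Or.inl ha⟩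

theorem minMoves_graphX {n m : ℕ} (hn : 1 ≤ n) (hm : 1 ≤ m) (p : Player) :
    minMoves (graphX n m) p = minMoves (graphY n ⊕g graphY m) p :=
  minMoves_congr (fun _ => isDominatingSet_graphX_iff hn hm) p

theorem minMoves_graphX_sum {n m : ℕ} (hn : 1 ≤ n) (hm : 1 ≤ m) {W : Type*} (H : SimpleGraph W)
    (p : Player) :
    minMoves (graphX n m ⊕g H) p = minMoves (graphY n ⊕g (graphY m ⊕g H)) p := by
  rw [← minMoves_iso SimpleGraph.Iso.sumAssoc]
  refine minMoves_congr (fun D => ?_) p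
  rw [isDominatingSet_sum_iff, isDominatingSet_sum_iff, isDominatingSet_graphX_iff hn hm]

theorem one_le_card_of_isDominatingSet_graphY {k : ℕ} (hk : 1 ≤ k) {F : Finset (VertY k)}
    (h : IsDominatingSet (graphY k) F) : 1 ≤ F.card := by
  rw [isDominatingSet_graphY_iff hk] at h
  refine Finset.card_pos.2 ?_
  rcases h with h | h
  · exact ⟨_, Finset.mem_coe.1 h⟩
  · obtain ⟨b, hb⟩ := h ⟨0, hk⟩
    exact ⟨_, Finset.mem_coe.1 hb⟩

theorem le_card_of_isDominatingSet_graphY {k : ℕ} (hk : 1 ≤ k) {F : Finset (VertY k)}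
    (h : IsDominatingSet (graphY k) F) (hc : none ∉ F) : k ≤ F.card := by
  have h := ((isDominatingSet_graphY_iff hk).1 h).resolve_left (by simpa using hc)
  choose b hb using h
  have := Finset.card_le_card_of_injOn (s := Finset.univ) (t := F)
    (fun i : Fin k => (some (i, b i) : VertY k)) (fun i _ => hb i)
    (fun i _ j _ hij => congrArg Prod.fst (Option.some.inj hij))
  simpa using this

theorem card_toLeft_toRight_of_isDominatingSet {k l : ℕ} {F : Finset (VertY k ⊕ VertY l)}
    (h : IsDominatingSet (graphY k ⊕g graphY l) F) :
    IsDominatingSet (graphY k) (F.toLeft : Set (VertY k)) ∧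
      IsDominatingSet (graphY l) (F.toRight : Set (VertY l)) := by
  convert isDominatingSet_sum_iff.1 h using 2 <;> ext <;> simp

theorem canWin_staller_graphY {k : ℕ} (hk : 1 ≤ k) {S : Set (VertY k)}
    (hS : ∀ p, some p ∉ S) : CanWin (graphY k) .staller k ∅ S := by
  have := CanWin.of_pairing (G := graphY k) (D := ∅) (S := S) some (Option.some_injective _)
    Finset.univ (by simpa using hS)
    (fun D' _ h => (isDominatingSet_graphY_iff hk).2 (Or.inr fun i => h i (Finset.mem_univ i)))
  simpa using this

theorem canWin_dominator_graphY {k : ℕ} (hk : 1 ≤ k) {S : Set (VertY k)} (hS : none ∉ S) :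
    CanWin (graphY k) .dominator 1 ∅ S :=
  .dominatorMove none (by simpa using hS)
    (.dominated ((isDominatingSet_graphY_iff hk).2 (Or.inl (by simp))))

theorem gammaMB_graphY {k : ℕ} (hk : 1 ≤ k) : gammaMB (graphY k) = 1 := by
  apply le_antisymm
  · exact_mod_cast minMoves_le_iff.2 (canWin_dominator_graphY hk (Set.notMem_empty _))
  · refine le_minMoves fun j h => ?_
    obtain ⟨F, hF, -, hd⟩ := h.exists_finset
    rw [Set.empty_union] at hd
    exact_mod_cast (one_le_card_of_isDominatingSet_graphY hk hd).trans hF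

theorem gammaMB'_graphY {k : ℕ} (hk : 1 ≤ k) : gammaMB' (graphY k) = k := by
  refine le_antisymm (minMoves_le_iff.2 (canWin_staller_graphY hk (by simp))) (le_minMoves fun j h => ?_)
  have h : ∃ F : Finset (VertY k), F.card ≤ j ∧ none ∉ F ∧ IsDominatingSet (graphY k) F := by
    cases h with
    | dominated hD =>
      exact ⟨∅, by simp, by simp, by simpa using hD⟩
    | stallerMove _ h =>
      obtain ⟨F, hF, hS, hd⟩ := (h none (by simp)).exists_finset
      rw [Set.empty_union] at hd
      exact ⟨F, hF, by simpa using hS, hd⟩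
  obtain ⟨F, hF, hc, hd⟩ := h
  exact_mod_cast (le_card_of_isDominatingSet_graphY hk hd hc).trans hF

/-- Dominator's first move leaves a centre free, and Staller takes it. That part then costs at least
`k` vertices and the other at least one. -/
theorem gammaMB_graphY_sum {k l : ℕ} (hk : 1 ≤ k) (hkl : k ≤ l) :
    gammaMB (graphY k ⊕g graphY l) = k + 1 := by
  have hl := hk.trans hkl
  apply le_antisymm
  · rw [← gammaMB'_graphY hk, ← gammaMB_graphY hl]
    exact gammaMB_sum_le' _ _
  refine le_minMoves fun j h => ?_
  have h : ∃ F : Finset (VertY k ⊕ VertY l), F.card ≤ j ∧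
      (Sum.inl none ∉ F ∨ Sum.inr none ∉ F) ∧ IsDominatingSet (graphY k ⊕g graphY l) F := by
    cases h with
    | dominated hD => exact ⟨∅, by simp, by simp, by simpa using hD⟩
    | @dominatorMove j _ _ v hv h =>
      obtain ⟨c, hc, hcv⟩ : ∃ c : VertY k ⊕ VertY l, (c = Sum.inl none ∨ c = Sum.inr none) ∧
          c ≠ v := by
        by_cases h : v = Sum.inl none
        · exact ⟨Sum.inr none, Or.inr rfl, by simp [h]⟩
        · exact ⟨Sum.inl none, Or.inl rfl, fun h' => h h'.symm⟩
      have h : ∃ F : Finset (VertY k ⊕ VertY l), F.card ≤ j ∧ c ∉ F ∧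
          IsDominatingSet (graphY k ⊕g graphY l) (insert v ∅ ∪ F) := by
        cases h with
        | dominated hD => exact ⟨∅, by simp, by simp, by simpa using hD⟩
        | stallerMove _ h =>
          obtain ⟨F, hF, hS, hd⟩ := (h c (by simpa using hcv)).exists_finset
          exact ⟨F, hF, by simpa using hS, hd⟩
      obtain ⟨F, hF, hcF, hd⟩ := h
      have hcF' : c ∉ insert v F := by simp [hcv, hcF]
      refine ⟨insert v F, (Finset.card_insert_le _ _).trans (by omega), ?_, ?_⟩
      · rcases hc with rfl | rfl
        · exact Or.inl hcF'
        · exact Or.inr hcF'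
      · convert hd using 1
        ext
        simp
  obtain ⟨F, hF, hc, hd⟩ := h
  obtain ⟨hL, hR⟩ := card_toLeft_toRight_of_isDominatingSet hd
  have hcard := F.card_toLeft_add_card_toRight
  have : k + 1 ≤ j := by
    rcases hc with hc | hc
    · have h1 := le_card_of_isDominatingSet_graphY hk hL (by simpa using hc)
      have h2 := one_le_card_of_isDominatingSet_graphY hl hR
      omega
    · have h1 := one_le_card_of_isDominatingSet_graphY hk hL
      have h2 := le_card_of_isDominatingSet_graphY hl hR (by simpa using hc)
      omega
  exact_mod_cast this

/-- If Staller opens at a centre, Dominator takes the other centre; if at an outer vertex, he takes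
the centre of that part. Either way the remaining part has all its pairs free, and pairing there
costs at most `l`. -/
theorem gammaMB'_graphY_sum {k l : ℕ} (hk : 1 ≤ k) (hkl : k ≤ l) :
    gammaMB' (graphY k ⊕g graphY l) = 1 + l := by
  have hl := hk.trans hkl
  apply le_antisymm
  swap
  · rw [← gammaMB_graphY hk, ← gammaMB'_graphY hl]
    exact gammaMB_add_gammaMB'_le _ _
  have h : CanWin (graphY k ⊕g graphY l) .staller (l + 1) (sumSet ∅ ∅) (sumSet ∅ ∅) := by
    refine .stallerMove ⟨Sum.inl none, by rintro (h | h) <;> exact h⟩ ?_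
    have hleft : ∀ {S : Set (VertY k)} {S' : Set (VertY l)}, none ∉ S → (∀ p, some p ∉ S') →
        CanWin (graphY k ⊕g graphY l) .dominator (l + 1) (sumSet ∅ ∅) (sumSet S S') :=
      fun hS hS' => ((canWin_dominator_graphY hk hS).sum_dominator
        (canWin_staller_graphY hl hS')).mono_nat (by omega)
    have hright : ∀ {S : Set (VertY k)} {S' : Set (VertY l)}, (∀ p, some p ∉ S) → none ∉ S' →
        CanWin (graphY k ⊕g graphY l) .dominator (l + 1) (sumSet ∅ ∅) (sumSet S S') :=
      fun hS hS' => ((canWin_dominator_graphY hl hS').sum_dominator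
        (canWin_staller_graphY hk hS)).swap.mono_nat (by omega)
    rintro ((_ | w) | (_ | w)) -
    · rw [insert_inl_sumSet]
      exact hright (by simp) (by simp)
    · rw [insert_inl_sumSet]
      exact hleft (by simp) (by simp)
    · rw [insert_inr_sumSet]
      exact hleft (by simp) (by simp)
    · rw [insert_inr_sumSet]
      exact hright (by simp) (by simp)
  rw [sumSet_empty, ← minMoves_le_iff] at h
  rw [add_comm]
  exact_mod_cast h

theorem gammaMB_graphX {n m : ℕ} (hm : 1 ≤ m) (hmn : m ≤ n) :
    gammaMB (graphX n m) = m + 1 := by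
  rw [gammaMB, minMoves_graphX (hm.trans hmn) hm, ← gammaMB, gammaMB_sum_comm]
  exact gammaMB_graphY_sum hm hmn

theorem gammaMB'_graphX {n m : ℕ} (hm : 1 ≤ m) (hmn : m ≤ n) :
    gammaMB' (graphX n m) = n + 1 := by
  rw [gammaMB', minMoves_graphX (hm.trans hmn) hm, ← gammaMB', gammaMB'_sum_comm,
    gammaMB'_graphY_sum hm hmn, add_comm]

/-- Splitting off `Y_k` gives too weak an upper bound in general. Regrouping as `Y_n` and `Y_m ∪
Y_k` gives `1 + (1 + m)`. -/
theorem gammaMB_graphX_sum {n m k : ℕ} (hk : 1 ≤ k) (hkm : k ≤ m) (hmn : m ≤ n) :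
    gammaMB (graphX n m ⊕g graphY k) = m + 2 := by
  have hm := hk.trans hkm
  apply le_antisymm
  · rw [gammaMB, minMoves_graphX_sum (hm.trans hmn) hm, ← gammaMB]
    refine (gammaMB_sum_le _ _).trans_eq ?_
    rw [gammaMB_graphY (hm.trans hmn), gammaMB'_sum_comm, gammaMB'_graphY_sum hk hkm,
      ← add_assoc, one_add_one_eq_two, add_comm]
  · refine le_trans ?_ (gammaMB_add_le _ _)
    rw [gammaMB_graphX hm hmn, gammaMB_graphY hk, add_assoc, one_add_one_eq_two]

/-- The same regrouping yields the lower bound `n + (k + 1)`. -/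
theorem gammaMB'_graphX_sum {n m k : ℕ} (hk : 1 ≤ k) (hkm : k ≤ m) (hmn : m ≤ n) :
    gammaMB' (graphX n m ⊕g graphY k) = n + 1 + k := by
  have hm := hk.trans hkm
  apply le_antisymm
  · refine (gammaMB'_sum_le _ _).trans_eq ?_
    rw [gammaMB'_graphX hm hmn, gammaMB'_graphY hk]
  · rw [gammaMB', minMoves_graphX_sum (hm.trans hmn) hm, ← gammaMB']
    refine le_trans (le_of_eq ?_) (gammaMB'_add_gammaMB_le _ _)
    rw [gammaMB'_graphY (hm.trans hmn), gammaMB_sum_comm, gammaMB_graphY_sum hk hkm, add_assoc,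
      add_comm 1]

end Families

end MBDomination

theorem theorem6p1 :
    -- the bounds, for arbitrary finite graphs
    (∀ {V : Type*} {W : Type*} [Finite V] [Finite W] (G : SimpleGraph V) (H : SimpleGraph W),
      (MBDomination.gammaMB G + MBDomination.gammaMB H ≤ MBDomination.gammaMB (G ⊕g H) ∧
        MBDomination.gammaMB (G ⊕g H) ≤
          min (MBDomination.gammaMB' G + MBDomination.gammaMB H)
            (MBDomination.gammaMB G + MBDomination.gammaMB' H)) ∧
      (max (MBDomination.gammaMB' G + MBDomination.gammaMB H)
            (MBDomination.gammaMB G + MBDomination.gammaMB' H) ≤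
          MBDomination.gammaMB' (G ⊕g H) ∧
        MBDomination.gammaMB' (G ⊕g H) ≤ MBDomination.gammaMB' G + MBDomination.gammaMB' H)) ∧
    -- the invariants of the graphs `X_{n,m}` and `Y_k`
    (∀ n m : ℕ, 1 ≤ m → m ≤ n →
      MBDomination.gammaMB (MBDomination.graphX n m) = (m : ℕ∞) + 1 ∧
      MBDomination.gammaMB' (MBDomination.graphX n m) = (n : ℕ∞) + 1) ∧
    (∀ k : ℕ, 1 ≤ k →
      MBDomination.gammaMB (MBDomination.graphY k) = 1 ∧
      MBDomination.gammaMB' (MBDomination.graphY k) = (k : ℕ∞)) ∧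
    -- the lower bound of (i) and the upper bound of (ii) are attained
    (∀ n m k : ℕ, 1 ≤ k → k ≤ m → m ≤ n →
      (MBDomination.gammaMB (MBDomination.graphX n m ⊕g MBDomination.graphY k) =
          MBDomination.gammaMB (MBDomination.graphX n m) +
            MBDomination.gammaMB (MBDomination.graphY k) ∧
        MBDomination.gammaMB (MBDomination.graphX n m ⊕g MBDomination.graphY k) =
          (m : ℕ∞) + 2) ∧
      (MBDomination.gammaMB' (MBDomination.graphX n m ⊕g MBDomination.graphY k) =
          MBDomination.gammaMB' (MBDomination.graphX n m) +
            MBDomination.gammaMB' (MBDomination.graphY k) ∧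
        MBDomination.gammaMB' (MBDomination.graphX n m ⊕g MBDomination.graphY k) =
          (n : ℕ∞) + 1 + (k : ℕ∞))) ∧
    -- the upper bound of (i) and the lower bound of (ii) are attained
    (∀ k l : ℕ, 1 ≤ k → k ≤ l →
      (MBDomination.gammaMB (MBDomination.graphY k ⊕g MBDomination.graphY l) =
          min (MBDomination.gammaMB' (MBDomination.graphY k) +
                MBDomination.gammaMB (MBDomination.graphY l))
            (MBDomination.gammaMB (MBDomination.graphY k) +
              MBDomination.gammaMB' (MBDomination.graphY l)) ∧
        MBDomination.gammaMB (MBDomination.graphY k ⊕g MBDomination.graphY l) = (k : ℕ∞) + 1) ∧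
      (MBDomination.gammaMB' (MBDomination.graphY k ⊕g MBDomination.graphY l) =
          max (MBDomination.gammaMB' (MBDomination.graphY k) +
                MBDomination.gammaMB (MBDomination.graphY l))
            (MBDomination.gammaMB (MBDomination.graphY k) +
              MBDomination.gammaMB' (MBDomination.graphY l)) ∧
        MBDomination.gammaMB' (MBDomination.graphY k ⊕g MBDomination.graphY l) =
          1 + (l : ℕ∞))) := by
  refine ⟨fun G H => ⟨⟨MBDomination.gammaMB_add_le G H,
      le_min (MBDomination.gammaMB_sum_le' G H) (MBDomination.gammaMB_sum_le G H)⟩,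
      max_le (MBDomination.gammaMB'_add_gammaMB_le G H) (MBDomination.gammaMB_add_gammaMB'_le G H),
      MBDomination.gammaMB'_sum_le G H⟩,
    fun n m hm hmn => ⟨MBDomination.gammaMB_graphX hm hmn, MBDomination.gammaMB'_graphX hm hmn⟩,
    fun k hk => ⟨MBDomination.gammaMB_graphY hk, MBDomination.gammaMB'_graphY hk⟩,
    fun n m k hk hkm hmn => ?_, fun k l hk hkl => ?_⟩
  · rw [MBDomination.gammaMB_graphX_sum hk hkm hmn, MBDomination.gammaMB'_graphX_sum hk hkm hmn,
      MBDomination.gammaMB_graphX (hk.trans hkm) hmn,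
      MBDomination.gammaMB'_graphX (hk.trans hkm) hmn, MBDomination.gammaMB_graphY hk,
      MBDomination.gammaMB'_graphY hk, add_assoc, one_add_one_eq_two]
    exact ⟨⟨rfl, rfl⟩, rfl, rfl⟩
  · have hkl' : (k : ℕ∞) ≤ l := by exact_mod_cast hkl
    rw [MBDomination.gammaMB_graphY_sum hk hkl, MBDomination.gammaMB'_graphY_sum hk hkl,
      MBDomination.gammaMB_graphY hk, MBDomination.gammaMB'_graphY hk,
      MBDomination.gammaMB_graphY (hk.trans hkl), MBDomination.gammaMB'_graphY (hk.trans hkl),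
      add_comm (1 : ℕ∞), min_eq_left (by gcongr), max_eq_right (by gcongr)]
    exact ⟨⟨rfl, rfl⟩, rfl, rfl⟩
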